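/- Let $n\in\mathbb{N}$ and let $\alpha_1,\alpha_2\in\mathbb{R}$ satisfy $\alpha_1+\alpha_2\neq 0$. For $m\ge 1$ let $P=P(m)\in\mathbb{R}^{m\times m}$ be the matrix whose last row and last column are zero and whose entries for $1\le i,j\le m-1$ are $P_{ij}=c_1$ if $i=j$, $P_{ij}=c_2$ if $i<j$, and $P_{ij}=\alpha_2$ if $i>j$, where $c_1=2\alpha_2-(\alpha_1+\alpha_2)^2$ and $c_2=\alpha_2-(\alpha_1+\alpha_2)^2$. Suppose that $2\alpha_2-(\alpha_1+\alpha_2)^2=0$ and that $T_d\in\mathbb{R}^{2n\times 2n}$ is skew-symmetric. Then, for $m=\operatorname{rk}(T_d)+1$, there exists $W\in\mathbb{R}^{2n\times m}$ such that $$W P(m) W^\top = T_d,\qquad W\mathbb{1}=0,$$ where $\mathbb{1}\in\mathbb{R}^m$ is the all-ones vector. Moreover this length is minimal: if for some $m\ge 1$ there is a $W\in\mathbb{R}^{2n\times m}$ satisfying these two equations, then $m\ge \operatorname{rk}(T_d)+1$. -/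

import Mathlib

open scoped Matrix

/-- The `m × m` matrix `P`: its last row and last column vanish; on the leading
`(m - 1) × (m - 1)` block the diagonal entries are `c₁ = 2 α₂ - (α₁ + α₂)²`, the entries strictly
above the diagonal are `c₂ = α₂ - (α₁ + α₂)²`, and those strictly below it are `α₂`. -/
def explorationP (α₁ α₂ : ℝ) (m : ℕ) : Matrix (Fin m) (Fin m) ℝ :=
  Matrix.of fun i j =>
    if (i : ℕ) + 1 = m ∨ (j : ℕ) + 1 = m then 0
    else if i = j then 2 * α₂ - (α₁ + α₂) ^ 2
    else if i < j then α₂ - (α₁ + α₂) ^ 2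
    else α₂

/-- `W` (whose `m` columns are the exploration vectors in `ℝ²ⁿ`) solves
`W P Wᵀ = T_d` and `W 𝟙 = 0`. -/
def SolvesExploration (α₁ α₂ : ℝ) {n m : ℕ} (Td : Matrix (Fin (2 * n)) (Fin (2 * n)) ℝ)
    (W : Matrix (Fin (2 * n)) (Fin m) ℝ) : Prop :=
  W * explorationP α₁ α₂ m * Wᵀ = Td ∧ W *ᵥ (1 : Fin m → ℝ) = 0

/-! Since `(α₁ + α₂) ^ 2 = 2 * α₂`, the leading block of `P` is `α₂` times the tournament matrix,
with `α₂ > 0`. The last column of `W` does not affect `W P Wᵀ`, so it is free to enforce `W 𝟙 = 0`,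
and the rank of the product is at most `m - 1`: this is minimality. Existence is skew-symmetric
elimination: subtracting a wedge from `T` lowers its rank by at least two, and restoring it costs
two tournament columns. -/

/-- The skew-symmetric matrix with `-1` above the diagonal and `1` below it. -/
def tournamentMatrix (r : ℕ) : Matrix (Fin r) (Fin r) ℝ :=
  Matrix.of fun i j => if i = j then 0 else if i < j then -1 else 1

theorem mul_mul_transpose_apply {ι κ : Type*} [Fintype κ] (V : Matrix ι κ ℝ)
    (M : Matrix κ κ ℝ) (p q : ι) :
    (V * M * Vᵀ) p q = ∑ i, ∑ j, V p i * M i j * V q j := by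
  simp only [Matrix.mul_apply, Matrix.transpose_apply, Finset.sum_mul]
  exact Finset.sum_comm

theorem tournamentMatrix_succ_sum {r : ℕ} (f g : Fin (r + 1) → ℝ) :
    ∑ i, ∑ j, f i * tournamentMatrix (r + 1) i j * g j =
      (∑ i : Fin r, f i.succ) * g 0 - f 0 * (∑ j : Fin r, g j.succ) +
        ∑ i : Fin r, ∑ j : Fin r, f i.succ * tournamentMatrix r i j * g j.succ := by
  have hlt (j : Fin r) : tournamentMatrix (r + 1) 0 j.succ = -1 := by
    simp [tournamentMatrix, (Fin.succ_ne_zero j).symm]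
  have hgt (j : Fin r) : tournamentMatrix (r + 1) j.succ 0 = 1 := by
    simp [tournamentMatrix]
  have h00 : tournamentMatrix (r + 1) 0 0 = 0 := by simp [tournamentMatrix]
  have hs (i j : Fin r) : tournamentMatrix (r + 1) i.succ j.succ = tournamentMatrix r i j := by
    simp [tournamentMatrix]
  simp only [Fin.sum_univ_succ, hlt, hgt, h00, hs, Finset.sum_add_distrib]
  simp only [mul_neg, mul_one, mul_zero, zero_mul, neg_mul, Finset.sum_neg_distrib,
    Finset.sum_mul, Finset.mul_sum]
  ring

/-- Adding a decomposable skew-symmetric form to one congruent to the tournament matrix. -/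
theorem exists_tournament_add_wedge {ι : Type*} {r : ℕ} (V : Matrix ι (Fin r) ℝ) (u v : ι → ℝ) :
    ∃ V' : Matrix ι (Fin (r + 2)) ℝ,
      V' * tournamentMatrix (r + 2) * V'ᵀ =
        V * tournamentMatrix r * Vᵀ + Matrix.of fun p q => v p * u q - u p * v q := by
  -- The shifts by the row sums of `V` cancel the cross terms between the two new columns and the
  -- old ones.
  refine ⟨Matrix.of fun p => Fin.cons (u p + ∑ k, V p k) (Fin.cons (v p - ∑ k, V p k) (V p)), ?_⟩
  ext p q
  rw [Matrix.add_apply, mul_mul_transpose_apply, mul_mul_transpose_apply,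
    tournamentMatrix_succ_sum, tournamentMatrix_succ_sum]
  simp only [Matrix.of_apply, Fin.sum_univ_succ, Fin.cons_succ, Fin.cons_zero]
  ring

/-- Cutting the range of `T` by `x i = 0`, then by `x j = 0`, is strict each time: column `j`
violates the first condition, and column `i` meets the first but violates the second. -/
theorem rank_add_two_le_of_rows_eq_zero {ι : Type*} [Fintype ι]
    {T T' : Matrix ι ι ℝ} {i j : ι} (hii : T i i = 0) (hij : T i j ≠ 0) (hji : T j i ≠ 0)
    (hrange : LinearMap.range T'.mulVecLin ≤ LinearMap.range T.mulVecLin)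
    (hi : ∀ q, T' i q = 0) (hj : ∀ q, T' j q = 0) :
    T'.rank + 2 ≤ T.rank := by
  classical
  have hcol (M : Matrix ι ι ℝ) (k : ι) : M.mulVecLin (Pi.single k 1) = fun p => M p k := by
    ext p; simp
  let R := LinearMap.range T.mulVecLin
  let R₁ := R ⊓ LinearMap.ker (LinearMap.proj (R := ℝ) (φ := fun _ : ι => ℝ) i)
  let R₂ := R₁ ⊓ LinearMap.ker (LinearMap.proj (R := ℝ) (φ := fun _ : ι => ℝ) j)
  have hR (k : ι) : (fun p => T p k) ∈ R := ⟨Pi.single k 1, hcol T k⟩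
  have h₁ : R₁ < R := by
    refine lt_of_le_of_ne inf_le_left fun h => hij ?_
    have := hR j
    rw [← h] at this
    exact this.2
  have h₂ : R₂ < R₁ := by
    refine lt_of_le_of_ne inf_le_left fun h => hji ?_
    have : (fun p => T p i) ∈ R₁ := ⟨hR i, hii⟩
    rw [← h] at this
    exact this.2
  have h₃ : LinearMap.range T'.mulVecLin ≤ R₂ := by
    refine le_inf (le_inf hrange ?_) ?_
    · rintro _ ⟨x, rfl⟩
      simp [Matrix.mulVec, dotProduct, hi]
    · rintro _ ⟨x, rfl⟩
      simp [Matrix.mulVec, dotProduct, hj]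
  have e₁ := Submodule.finrank_lt_finrank_of_lt h₁
  have e₂ := Submodule.finrank_lt_finrank_of_lt h₂
  have e₃ := Submodule.finrank_mono h₃
  change Module.finrank ℝ (LinearMap.range T'.mulVecLin) + 2 ≤ Module.finrank ℝ R
  omega

/-- Every real skew-symmetric matrix is congruent to a tournament matrix
of size at most its rank. -/
theorem exists_tournament_congruence {ι : Type*} [Fintype ι]
    (T : Matrix ι ι ℝ) (hT : Tᵀ = -T) :
    ∃ r ≤ T.rank, ∃ V : Matrix ι (Fin r) ℝ, V * tournamentMatrix r * Vᵀ = T := by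
  classical
  induction hk : T.rank using Nat.strong_induction_on generalizing T with
  | _ k ih =>
    have hskew (p q : ι) : T q p = -T p q := congrFun (congrFun hT p) q
    have hdiag (p : ι) : T p p = 0 := by linarith [hskew p p]
    by_cases h0 : T = 0
    · exact ⟨0, Nat.zero_le _, 0, by simp [h0]⟩
    obtain ⟨i, j, hij⟩ : ∃ i j, T i j ≠ 0 := by
      by_contra! h
      exact h0 (Matrix.ext h)
    -- Pivot on the entry `(i, j)`: the scaling makes `v i = -1` and `u j * v i - v j * u i = T i
    -- j`, so the wedge agrees with `T` on rows `i` and `j`.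
    let u : ι → ℝ := fun p => T p i
    let v : ι → ℝ := fun p => -((T i j)⁻¹ * T p j)
    let T' : Matrix ι ι ℝ := T - Matrix.of fun p q => v p * u q - u p * v q
    have hT'skew : T'ᵀ = -T' := by
      ext p q
      simp only [T', Matrix.transpose_apply, Matrix.neg_apply, Matrix.sub_apply, Matrix.of_apply,
        hskew p q]
      ring
    have hrank : T'.rank + 2 ≤ T.rank := by
      refine rank_add_two_le_of_rows_eq_zero (hdiag i) hij
        (by rw [hskew i j]; exact neg_ne_zero.2 hij) ?_ ?_ ?_
      · rintro _ ⟨x, rfl⟩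
        -- `u` and `v` are multiples of columns `i` and `j` of `T`, so the wedge correction is
        -- absorbed into the argument.
        refine ⟨x + ((T i j)⁻¹ * (u ⬝ᵥ x)) • Pi.single j 1 + (v ⬝ᵥ x) • Pi.single i 1, ?_⟩
        have hT' : T' = T - (Matrix.vecMulVec v u - Matrix.vecMulVec u v) := rfl
        ext p
        simp [hT', Matrix.mulVec_add, Matrix.mulVec_smul,
          Matrix.vecMulVec_mulVec]
        simp only [u, v]
        ring
      · intro q
        simp only [T', u, v, Matrix.sub_apply, Matrix.of_apply, hdiag i, hskew i q]
        field_simp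
        ring
      · intro q
        simp only [T', u, v, Matrix.sub_apply, Matrix.of_apply, hdiag j, hskew i j, hskew j q]
        field_simp
        ring
    obtain ⟨r, hr, V, hV⟩ := ih T'.rank (by omega) T' hT'skew rfl
    obtain ⟨V', hV'⟩ := exists_tournament_add_wedge V u v
    exact ⟨r + 2, by omega, V', by rw [hV', hV]; exact sub_add_cancel _ _⟩

/-- When the diagonal entry vanishes, only the first `k` columns contribute to `W P Wᵀ`. -/
theorem mul_explorationP_mul_transpose {ι : Type*} {α₁ α₂ : ℝ}
    (hc : 2 * α₂ - (α₁ + α₂) ^ 2 = 0) {k : ℕ} (W : Matrix ι (Fin (k + 1)) ℝ) :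
    W * explorationP α₁ α₂ (k + 1) * Wᵀ =
      α₂ • (W.submatrix id Fin.castSucc * tournamentMatrix k *
        (W.submatrix id Fin.castSucc)ᵀ) := by
  have hlast (j : Fin (k + 1)) : explorationP α₁ α₂ (k + 1) (Fin.last k) j = 0 := by
    simp [explorationP]
  have hlast' (j : Fin (k + 1)) : explorationP α₁ α₂ (k + 1) j (Fin.last k) = 0 := by
    simp [explorationP]
  have hcs (i j : Fin k) : explorationP α₁ α₂ (k + 1) i.castSucc j.castSucc =
      α₂ * tournamentMatrix k i j := by
    have hi := i.2.ne
    have hj := j.2.ne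
    simp only [explorationP, tournamentMatrix, Matrix.of_apply, Fin.val_castSucc, hc,
      Nat.add_right_cancel_iff, hi, hj, or_self, if_false, Fin.castSucc_inj,
      Fin.castSucc_lt_castSucc_iff]
    split_ifs <;> linarith
  ext p q
  rw [Matrix.smul_apply, mul_mul_transpose_apply, mul_mul_transpose_apply, smul_eq_mul,
    Finset.mul_sum]
  simp only [Fin.sum_univ_castSucc, hlast, hlast', hcs, Finset.mul_sum, Matrix.submatrix_apply,
    id, mul_zero, zero_mul, add_zero, Finset.sum_const_zero]
  exact Finset.sum_congr rfl fun i _ => Finset.sum_congr rfl fun j _ => by ring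

theorem rank_smul_mul_mul_le {ι : Type*} [Fintype ι] {k : ℕ} (c : ℝ) (V : Matrix ι (Fin k) ℝ)
    (M : Matrix (Fin k) (Fin k) ℝ) : (c • (V * M * Vᵀ)).rank ≤ k := by
  rw [Matrix.mul_assoc, ← Matrix.smul_mul]
  exact (Matrix.rank_mul_le_left _ _).trans ((Matrix.rank_le_card_width _).trans_eq (Fintype.card_fin k))

theorem corollary1 (n : ℕ) (α₁ α₂ : ℝ) (hα : α₁ + α₂ ≠ 0)
    (hc : 2 * α₂ - (α₁ + α₂) ^ 2 = 0)
    (Td : Matrix (Fin (2 * n)) (Fin (2 * n)) ℝ) (hTd : Tdᵀ = -Td) :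
    (∃ W : Matrix (Fin (2 * n)) (Fin (Td.rank + 1)) ℝ, SolvesExploration α₁ α₂ Td W) ∧
      ∀ m : ℕ, 1 ≤ m →
        (∃ W : Matrix (Fin (2 * n)) (Fin m) ℝ, SolvesExploration α₁ α₂ Td W) →
          Td.rank + 1 ≤ m := by
  constructor
  · have hα₂ : 0 < α₂ := by linarith [pow_pos (abs_pos.2 hα) 2, sq_abs (α₁ + α₂)]
    obtain ⟨r, hr, V, hV⟩ := exists_tournament_congruence Td hTd
    -- A congruence of size `r` forces rank at most `r`, so the size is exact.
    obtain rfl : r = Td.rank := by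
      refine le_antisymm hr ?_
      conv_lhs => rw [← hV, ← one_smul ℝ (V * tournamentMatrix r * Vᵀ)]
      exact rank_smul_mul_mul_le 1 V _
    let s : ℝ := (√α₂)⁻¹
    have hs : α₂ * (s * s) = 1 := by
      rw [← mul_inv, Real.mul_self_sqrt hα₂.le, mul_inv_cancel₀ hα₂.ne']
    let W : Matrix (Fin (2 * n)) (Fin (Td.rank + 1)) ℝ :=
      Matrix.of fun p => Fin.snoc (α := fun _ => ℝ) ((s • V) p) (-∑ k, (s • V) p k)
    have hW : W.submatrix id Fin.castSucc = s • V := by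
      ext p k
      simp [W]
    refine ⟨W, ?_, ?_⟩
    · rw [mul_explorationP_mul_transpose hc, hW, Matrix.transpose_smul, Matrix.smul_mul,
        Matrix.smul_mul, Matrix.mul_smul, hV, smul_smul, smul_smul, mul_assoc, hs, one_smul]
    · ext p
      simp [Matrix.mulVec, dotProduct, Fin.sum_univ_castSucc, W]
  · rintro m hm ⟨W, hW, -⟩
    obtain ⟨k, rfl⟩ : ∃ k, m = k + 1 := ⟨m - 1, by omega⟩
    rw [mul_explorationP_mul_transpose hc] at hW
    rw [← hW]
    exact Nat.succ_le_succ (rank_smul_mul_mul_le _ _ _)
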